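/- Let $H$ be a real Hilbert space, let $E$ be a real Banach space, and let $F\colon[0,\infty)\to[0,\infty)$ be a map with $F(0)=0$ such that $t\mapsto F(\sqrt t)$ is strictly increasing and concave on $[0,\infty)$. Let $F[H]$ denote the set $H$ equipped with the distance function $\rho(x,y)=F(\|x-y\|_H)$, which is non-negative, symmetric and zero on the diagonal, but need not satisfy the triangle inequality. For $A\subset H$ and a map $g\colon A\to E$, let $$\operatorname{Lip}(g)=\inf\{L\ge 0:\ \|g(x)-g(y)\|_E\le L\,F(\|x-y\|_H)\ \text{for all }x,y\in A\},\qquad \inf\varnothing=+\infty.$$ If $X\subset F[H]$ is a finite subset, $S\subset X$ is non-empty, and $f\colon S\to E$ is a map, then there is a map $\overline f\colon X\to\operatorname{Conv}(\operatorname{Im} f)$ into the closed convex hull of the image of $f$ such that $\overline f|_S=f$, $\operatorname{Lip}(\overline f)<\infty$ and $$\operatorname{Lip}(\overline f)\ \le\ \sup_{x>0}\frac{F(\sqrt{m+1}\,x)}{F(x)}\ \operatorname{Lip}(f),\qquad m:=|X\setminus S|.$$ In particular, if $F=\mathrm{id}$, then $\operatorname{Lip}(\overline f)\le\sqrt{m+1}\,\operatorname{Lip}(f)$.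 -/

import Mathlib

open scoped NNReal ENNReal

/-- A quasi-metric on `X`: a non-negative, symmetric function on `X × X` that vanishes on the
diagonal. (No triangle inequality is required.) -/
structure QuasiMetric (X : Type*) where
  /-- the distance function -/
  dist : X → X → ℝ≥0
  dist_self : ∀ x, dist x x = 0
  dist_symm : ∀ x y, dist x y = dist y x

namespace QuasiMetric

/-- The quasi-metric underlying a (pseudo)metric space. -/
noncomputable def ofMetric (X : Type*) [PseudoMetricSpace X] : QuasiMetric X where
  dist x y := nndist x y
  dist_self x := nndist_self x
  dist_symm x y := nndist_comm x y

/-- The `F`-transform `F[X]` of a quasi-metric space: the same points, with the distance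
`F ∘ ρ`, where `F 0 = 0`. -/
def transform {X : Type*} (F : ℝ≥0 → ℝ≥0) (hF : F 0 = 0) (ρ : QuasiMetric X) :
    QuasiMetric X where
  dist x y := F (ρ.dist x y)
  dist_self x := by rw [ρ.dist_self, hF]
  dist_symm x y := by rw [ρ.dist_symm]

/-- The induced quasi-metric on a subset. -/
def restrict {X : Type*} (ρ : QuasiMetric X) (A : Set X) : QuasiMetric A where
  dist x y := ρ.dist x y
  dist_self x := ρ.dist_self x
  dist_symm x y := ρ.dist_symm x y

/-- The Lipschitz constant of a map between quasi-metric spaces: the infimum of all real `L ≥ 0`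
with `σ (f x) (f y) ≤ L * ρ x y` for all `x, y`, where the infimum of the empty set is `∞`. -/
noncomputable def lip {X Y : Type*} (ρ : QuasiMetric X) (σ : QuasiMetric Y) (f : X → Y) : ℝ≥0∞ :=
  ⨅ (L : ℝ≥0) (_ : ∀ x y, σ.dist (f x) (f y) ≤ L * ρ.dist x y), (L : ℝ≥0∞)

end QuasiMetric

/-! Put `G t = F (√t)`, `N = m + 1`, and let `p`, `q` list the points of `S` and of `X \ S`. The new
values `g t` are sought in the compact convex hull of the finite image of `f`, subject to the convex
constraints `‖g t - f s‖ ≤ C * G (N * ‖q t - p s‖ ^ 2)` and likewise for pairs of new points. By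
Hahn–Banach separation (`exists_forall_le_of_forall_weights`) it is enough to satisfy each positive
combination of them, with `g` depending on the weights.

Given weights, replace `G` at each right-hand argument by its supporting line. Weights times slopes
are the conductances of an electrical network with boundary `S`, and `g` is the harmonic extension
of `f`, an average against the hitting distributions `lam`. Differences of values of `g` are
averages of differences of `f`, so concavity of `G` reduces the claim to an inequality for squared
distances in `H`.

That inequality is `exists_hitting_distributions`. Let `Q` be the response form of the network at
`p`. The boundary edges contribute `2 * Q`. By the strong Markov property at an interior vertex `k`
and the Green function bound `v i k * v k j ≤ v i j * v k k`, the interior edges contribute at most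
`m * Q - Q`. The total is at most `(m + 1) * Q`, and `Q` is at most the energy of `q` by the
Dirichlet principle. -/

/-! ### Convexity: minimax and supporting lines. -/

open scoped Pointwise in
/-- A minimax principle: finitely many convex inequalities on a compact convex set can be solved
simultaneously if every positive combination of them can be solved. -/
theorem exists_forall_le_of_forall_weights {ι V : Type*} [Fintype ι] [NormedAddCommGroup V]
    [NormedSpace ℝ V] {K : Set V} (hK : IsCompact K) {φ : ι → V → ℝ}
    (hconv : ∀ i, ConvexOn ℝ K (φ i)) (hcont : ∀ i, Continuous (φ i))
    (hnonneg : ∀ i x, 0 ≤ φ i x) (b : ι → ℝ)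
    (h : ∀ w : ι → ℝ, (∀ i, 0 < w i) → ∃ x ∈ K, ∑ i, w i * φ i x ≤ ∑ i, w i * b i) :
    ∃ x ∈ K, ∀ i, φ i x ≤ b i := by
  classical
  by_contra hb
  set D : Set (ι → ℝ) := (fun x i => φ i x) '' K + Set.Ici (0 : ι → ℝ) with hD
  have memD : ∀ u, u ∈ D ↔ ∃ x ∈ K, ∀ i, φ i x ≤ u i := by
    intro u
    simp only [hD, Set.mem_add, Set.mem_image, Set.mem_Ici]
    constructor
    · rintro ⟨_, ⟨x, hx, rfl⟩, y, hy, rfl⟩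
      exact ⟨x, hx, fun i => by simpa using hy i⟩
    · rintro ⟨x, hx, hu⟩
      exact ⟨_, ⟨x, hx, rfl⟩, u - fun i => φ i x, fun i => by simpa using hu i, by simp⟩
  have hclosed : IsClosed D :=
    isClosed_Ici.add_left_of_isCompact (hK.image (continuous_pi hcont))
  have hconvex : Convex ℝ D := by
    intro u hu v hv s t hs ht hst
    obtain ⟨x, hx, hxu⟩ := (memD u).1 hu
    obtain ⟨y, hy, hyv⟩ := (memD v).1 hv
    obtain ⟨x₀, hx₀, -⟩ := h (fun _ => 1) (fun _ => one_pos)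
    -- For empty `ι` no `φ i` is available to witness that `K` is convex, but then any point of `K`
    -- will do.
    refine (memD _).2 ⟨if Nonempty ι then s • x + t • y else x₀, ?_, fun i => ?_⟩
    · split_ifs with hι
      · exact (hconv hι.some).1 hx hy hs ht hst
      · exact hx₀
    · rw [if_pos ⟨i⟩]
      refine ((hconv i).2 hx hy hs ht hst).trans ?_
      simp only [smul_eq_mul, Pi.add_apply, Pi.smul_apply]
      exact add_le_add (mul_le_mul_of_nonneg_left (hxu i) hs)
        (mul_le_mul_of_nonneg_left (hyv i) ht)
  have hbD : b ∉ D := fun hbD => hb ((memD b).1 hbD)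
  obtain ⟨l, c, hlb, hlD⟩ := geometric_hahn_banach_point_closed hconvex hclosed hbD
  have hl : ∀ u, l u = ∑ i, l (Pi.single i 1) * u i := by
    intro u
    conv_lhs => rw [← Finset.univ_sum_single u]
    rw [map_sum]
    refine Finset.sum_congr rfl fun i _ => ?_
    have : Pi.single i (u i) = u i • (Pi.single i (1 : ℝ) : ι → ℝ) := by
      ext j; by_cases hij : j = i
      · subst hij; simp
      · simp [hij]
    rw [this, map_smul, smul_eq_mul, mul_comm]
  obtain ⟨x₀, hx₀, -⟩ := h (fun _ => 1) (fun _ => one_pos)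
  -- `D` is stable under increasing a coordinate. If `l` were negative on the `i`-th axis, moving
  -- along it would bring `l` down to exactly `c` inside `D`.
  have hw0 : ∀ i, 0 ≤ l (Pi.single i 1) := by
    intro i
    by_contra! hneg
    set u₀ : ι → ℝ := fun i => φ i x₀
    have hu₀ := hlD u₀ ((memD _).2 ⟨x₀, hx₀, fun _ => le_rfl⟩)
    have hpos : 0 ≤ (l u₀ - c) / -l (Pi.single i 1) := by
      apply div_nonneg <;> linarith
    have := hlD (u₀ + ((l u₀ - c) / -l (Pi.single i 1)) • Pi.single i 1)
      ((memD _).2 ⟨x₀, hx₀, fun j => by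
        have : (0 : ℝ) ≤ (Pi.single i (1 : ℝ) : ι → ℝ) j := by
          by_cases hij : j = i
          · subst hij; simp
          · simp [hij]
        simpa [u₀] using mul_nonneg hpos this⟩)
    rw [map_add, map_smul, smul_eq_mul, div_mul_eq_mul_div, mul_div_assoc, div_neg,
      div_self hneg.ne] at this
    linarith
  set B := ∑ i, b i
  -- The separating weights are only non-negative. Adding `δ` makes them positive, and `δ * B ≤ c -
  -- l b` keeps the contradiction.
  set δ := (c - l b) / (|B| + 1)
  have hB : 0 < |B| + 1 := by positivity
  have hδ : 0 < δ := div_pos (by linarith) hB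
  have hδB : δ * B ≤ c - l b := by
    have h1 : δ * (|B| + 1) = c - l b := div_mul_cancel₀ _ hB.ne'
    nlinarith [le_abs_self B]
  obtain ⟨x, hx, hle⟩ := h (fun i => l (Pi.single i 1) + δ)
    (fun i => add_pos_of_nonneg_of_pos (hw0 i) hδ)
  simp only [add_mul, Finset.sum_add_distrib, ← Finset.mul_sum] at hle
  rw [← hl b, ← hl (fun i => φ i x)] at hle
  have h1 := hlD _ ((memD _).2 ⟨x, hx, fun _ => le_rfl⟩)
  have h2 : 0 ≤ δ * ∑ i, φ i x :=
    mul_nonneg hδ.le (Finset.sum_nonneg fun i _ => hnonneg i x)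
  linarith

/-- A strictly increasing concave function on the half-line has a positive supergradient at every
interior point. -/
theorem ConcaveOn.exists_pos_supergradient {G : ℝ → ℝ} (hG : ConcaveOn ℝ (Set.Ici 0) G)
    (hmono : StrictMonoOn G (Set.Ici 0)) {τ : ℝ} (hτ : 0 < τ) :
    ∃ σ : ℝ, 0 < σ ∧ ∀ t, 0 ≤ t → G t ≤ G τ + σ * (t - τ) := by
  have hτ0 : τ ∈ Set.Ici (0 : ℝ) := hτ.le
  -- The supporting slope is the supremum of the slopes to the right of `τ`; every slope from the
  -- left bounds them.
  set A : Set ℝ := (fun t => (G t - G τ) / (t - τ)) '' Set.Ioi τ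
  have hne : A.Nonempty := ⟨_, τ + 1, by simp, rfl⟩
  have key : ∀ s, 0 ≤ s → s < τ → (G τ - G s) / (τ - s) ∈ upperBounds A := by
    rintro s hs hsτ _ ⟨t, ht, rfl⟩
    exact hG.slope_anti_adjacent hs (hs.trans (hsτ.le.trans (le_of_lt ht))) hsτ ht
  have hbdd : BddAbove A := ⟨_, key 0 le_rfl hτ⟩
  refine ⟨sSup A, ?_, fun t ht => ?_⟩
  · refine lt_of_lt_of_le ?_ (le_csSup hbdd ⟨τ + 1, by simp, rfl⟩)
    have : G τ < G (τ + 1) := hmono hτ0 (by simp; linarith) (by linarith)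
    simpa using this
  · rcases lt_trichotomy t τ with h | h | h
    · have := csSup_le hne (key t ht h)
      rw [le_div_iff₀ (by linarith)] at this
      linarith
    · simp [h]
    · have := le_csSup hbdd ⟨t, h, rfl⟩
      simp only at this
      rw [div_le_iff₀ (by linarith)] at this
      linarith

/-! ### Electrical networks: Green function, Dirichlet principle, hitting distributions. -/

section Network

variable {S T : Type*} [Fintype S] [Fintype T]

/-- The grounded Laplacian on the interior vertices `T` of a network with boundary `S`, edge
weights `a` between `T` and `S`, and edge weights `n` inside `T`. -/
def groundedLaplacian (a : T → S → ℝ) (n : T → T → ℝ) (x : T → ℝ) (i : T) : ℝ :=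
  (∑ s, a i s + ∑ j, n i j) * x i - ∑ j, n i j * x j

/-- Minimum principle: at a negative minimum the boundary term is strictly negative and the interior
terms are non-positive. Requiring the hypothesis only where `x` is negative allows exceptional
vertices at which `x` vanishes. -/
theorem nonneg_of_groundedLaplacian_nonneg [Nonempty S] {a : T → S → ℝ} {n : T → T → ℝ}
    (ha : ∀ i s, 0 < a i s) (hn : ∀ i j, 0 ≤ n i j) {x : T → ℝ}
    (hx : ∀ i, x i < 0 → 0 ≤ groundedLaplacian a n x i) (i : T) : 0 ≤ x i := by
  obtain ⟨k, -, hk⟩ := Finset.exists_min_image Finset.univ x ⟨i, Finset.mem_univ i⟩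
  refine le_trans ?_ (hk i (Finset.mem_univ i))
  by_contra! hneg
  have h1 := hx k hneg
  have h2 : (∑ s, a k s) * x k < 0 :=
    mul_neg_of_pos_of_neg (Finset.sum_pos (fun s _ => ha k s) Finset.univ_nonempty) hneg
  have h3 : (∑ j, n k j) * x k ≤ ∑ j, n k j * x j := by
    rw [Finset.sum_mul]
    exact Finset.sum_le_sum fun j _ => mul_le_mul_of_nonneg_left (hk j (Finset.mem_univ j)) (hn k j)
  unfold groundedLaplacian at h1
  linarith

/-- Existence of the symmetric Green function of the grounded Laplacian, with its basic
inequalities. -/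
theorem exists_green [Nonempty S] [DecidableEq T] {a : T → S → ℝ} {n : T → T → ℝ}
    (ha : ∀ i s, 0 < a i s) (hn : ∀ i j, 0 ≤ n i j) (hsymm : ∀ i j, n i j = n j i) :
    ∃ v : T → T → ℝ, (∀ i j, v i j = v j i) ∧
      (∀ i k, groundedLaplacian a n (fun j => v j k) i = if i = k then 1 else 0) ∧
      (∀ i j, 0 ≤ v i j) ∧ (∀ i, 0 < v i i) ∧ ∀ i j k, v i k * v k j ≤ v i j * v k k := by
  set M : Matrix T T ℝ := Matrix.diagonal (fun i => ∑ s, a i s + ∑ j, n i j) - Matrix.of n with hM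
  have hMx : ∀ x i, (M.mulVec x) i = groundedLaplacian a n x i := by
    intro x i
    rw [hM, Matrix.sub_mulVec]
    simp [groundedLaplacian, Matrix.mulVec, dotProduct, Matrix.diagonal_apply]
  have hdet : IsUnit M.det := by
    rw [isUnit_iff_ne_zero]
    intro h0
    obtain ⟨x, hx, hMx0⟩ := Matrix.exists_mulVec_eq_zero_iff.2 h0
    refine hx (funext fun i => le_antisymm ?_ ?_)
    · have := nonneg_of_groundedLaplacian_nonneg ha hn (x := -x)
        (fun i _ => by rw [← hMx, Matrix.mulVec_neg, hMx0]; simp) i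
      simpa using this
    · exact nonneg_of_groundedLaplacian_nonneg ha hn
        (fun i _ => by rw [← hMx, hMx0]; simp) i
  have hMt : M.transpose = M := by
    rw [hM, Matrix.transpose_sub, Matrix.diagonal_transpose]
    congr 1
    ext i j
    exact hsymm j i
  have hG : ∀ i k, groundedLaplacian a n (fun j => M⁻¹ j k) i = if i = k then 1 else 0 := by
    intro i k
    rw [← hMx, ← Matrix.one_apply, ← Matrix.mul_nonsing_inv M hdet]
    rfl
  have hvs : ∀ i j, M⁻¹ i j = M⁻¹ j i := by
    intro i j
    conv_lhs => rw [← hMt, ← Matrix.transpose_nonsing_inv]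
    rfl
  have hv0 : ∀ i j, 0 ≤ M⁻¹ i j := fun i j =>
    nonneg_of_groundedLaplacian_nonneg ha hn (x := fun i => M⁻¹ i j)
      (fun i _ => by rw [hG]; split_ifs <;> norm_num) i
  refine ⟨fun i j => M⁻¹ i j, hvs, hG, hv0, fun i => (hv0 i i).lt_of_ne' fun h0 => ?_, fun i j k => ?_⟩
  · have h1 := hG i i
    simp only [groundedLaplacian, h0, if_true, mul_zero, zero_sub] at h1
    have : 0 ≤ ∑ j, n i j * M⁻¹ j i := Finset.sum_nonneg fun j _ => mul_nonneg (hn i j) (hv0 j i)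
    linarith
  -- As a function of `i`, the difference of the two sides vanishes at `k` and has non-negative
  -- Laplacian elsewhere.
  · have := nonneg_of_groundedLaplacian_nonneg ha hn
      (x := fun i => M⁻¹ i j * M⁻¹ k k - M⁻¹ i k * M⁻¹ k j) (fun l hl => ?_) i
    · linarith
    · have hlin : groundedLaplacian a n (fun i => M⁻¹ i j * M⁻¹ k k - M⁻¹ i k * M⁻¹ k j) l
          = groundedLaplacian a n (fun i => M⁻¹ i j) l * M⁻¹ k k
            - groundedLaplacian a n (fun i => M⁻¹ i k) l * M⁻¹ k j := by
        simp only [groundedLaplacian, mul_sub, sub_mul, Finset.sum_sub_distrib, Finset.sum_mul,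
          mul_assoc]
        ring
      rw [hlin, hG, hG]
      rcases eq_or_ne l k with rfl | hlk
      · simp only [mul_comm, sub_self, lt_irrefl] at hl
      · rw [if_neg hlk]
        have : (0 : ℝ) ≤ if l = j then 1 else 0 := by split_ifs <;> norm_num
        simpa using mul_nonneg this (hv0 k k)

/-- The Dirichlet principle: `½ ∑ c s s' ‖p s - p s'‖²`, with `c` the response matrix of the
network, is at most the energy of every extension `q` of the boundary values `p`. -/
theorem response_energy_le {H : Type*} [NormedAddCommGroup H] [InnerProductSpace ℝ H]
    {a lam : T → S → ℝ} {n : T → T → ℝ}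
    (ha : ∀ i s, 0 ≤ a i s) (hn : ∀ i j, 0 ≤ n i j) (hsymm : ∀ i j, n i j = n j i)
    (hlam : ∀ i, ∑ s, lam i s = 1)
    (hharm : ∀ i s, (∑ s, a i s + ∑ j, n i j) * lam i s - ∑ j, n i j * lam j s = a i s)
    (hc : ∀ s s', ∑ i, a i s * lam i s' = ∑ i, a i s' * lam i s) (p : S → H) (q : T → H) :
    ∑ i, ∑ s, a i s * ∑ s', lam i s' * ‖p s - p s'‖ ^ 2 ≤
      2 * ∑ i, ∑ s, a i s * ‖q i - p s‖ ^ 2 + ∑ i, ∑ j, n i j * ‖q i - q j‖ ^ 2 := by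
  set h : T → H := fun i => ∑ s, lam i s • p s with hh
  have hbal : ∀ i, ∑ s, a i s • (h i - p s) + ∑ j, n i j • (h i - h j) = 0 := by
    intro i
    have h1 : ∑ s, a i s • p s = ((∑ s, a i s) + ∑ j, n i j) • h i - ∑ j, n i j • h j := by
      simp only [hh, Finset.smul_sum, smul_smul]
      rw [Finset.sum_comm, ← Finset.sum_sub_distrib]
      refine Finset.sum_congr rfl fun s _ => ?_
      rw [← Finset.sum_smul, ← sub_smul, hharm]
    simp only [smul_sub, Finset.sum_sub_distrib, ← Finset.sum_smul]
    rw [h1, add_smul]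
    abel
  have hbal' : ∀ (u : T → H), ∑ i, ∑ s, a i s * inner ℝ (u i) (h i - p s)
      + ∑ i, ∑ j, n i j * inner ℝ (u i) (h i - h j) = 0 := by
    intro u
    rw [← Finset.sum_add_distrib]
    refine Finset.sum_eq_zero fun i _ => ?_
    have := congrArg (inner ℝ (u i)) (hbal i)
    simpa [inner_add_right, inner_sum, inner_smul_right] using this
  have hsw : ∀ (u : T → H), ∑ i, ∑ j, n i j * inner ℝ (u i - u j) (h i - h j)
      = 2 * ∑ i, ∑ j, n i j * inner ℝ (u i) (h i - h j) := by
    intro u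
    have h2 : ∑ i, ∑ j, n i j * inner ℝ (u j) (h i - h j)
        = - ∑ i, ∑ j, n i j * inner ℝ (u i) (h i - h j) := by
      rw [Finset.sum_comm, ← Finset.sum_neg_distrib]
      refine Finset.sum_congr rfl fun i _ => ?_
      rw [← Finset.sum_neg_distrib]
      refine Finset.sum_congr rfl fun j _ => ?_
      rw [hsymm j i, ← neg_sub (h i) (h j), inner_neg_right]
      ring
    simp only [inner_sub_left, mul_sub, Finset.sum_sub_distrib]
    linarith
  -- Pythagoras: the cross terms between `h` and `q - h` vanish because `h` is harmonic.
  have hexp : 2 * ∑ i, ∑ s, a i s * ‖q i - p s‖ ^ 2 + ∑ i, ∑ j, n i j * ‖q i - q j‖ ^ 2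
      = (2 * ∑ i, ∑ s, a i s * ‖h i - p s‖ ^ 2 + ∑ i, ∑ j, n i j * ‖h i - h j‖ ^ 2)
        + (2 * ∑ i, ∑ s, a i s * ‖q i - h i‖ ^ 2
            + ∑ i, ∑ j, n i j * ‖(q i - h i) - (q j - h j)‖ ^ 2) := by
    have e1 : ∀ i s, a i s * ‖q i - p s‖ ^ 2 = a i s * ‖h i - p s‖ ^ 2 + a i s * ‖q i - h i‖ ^ 2
        + 2 * (a i s * inner ℝ (q i - h i) (h i - p s)) := by
      intro i s
      have : q i - p s = (q i - h i) + (h i - p s) := by abel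
      rw [this, norm_add_sq_real]; ring
    have e2 : ∀ i j, n i j * ‖q i - q j‖ ^ 2 = n i j * ‖h i - h j‖ ^ 2
        + n i j * ‖(q i - h i) - (q j - h j)‖ ^ 2
        + 2 * (n i j * inner ℝ ((q i - h i) - (q j - h j)) (h i - h j)) := by
      intro i j
      have : q i - q j = ((q i - h i) - (q j - h j)) + (h i - h j) := by abel
      rw [this, norm_add_sq_real]; ring
    simp only [e1, e2, Finset.sum_add_distrib, ← Finset.mul_sum]
    have h3 := hbal' (fun i => q i - h i)
    have h4 := hsw (fun i => q i - h i)
    rw [h4]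
    linarith
  have hpos : 0 ≤ 2 * ∑ i, ∑ s, a i s * ‖q i - h i‖ ^ 2
      + ∑ i, ∑ j, n i j * ‖(q i - h i) - (q j - h j)‖ ^ 2 := by
    have h5 : 0 ≤ ∑ i, ∑ s, a i s * ‖q i - h i‖ ^ 2 := Finset.sum_nonneg fun i _ =>
      Finset.sum_nonneg fun s _ => mul_nonneg (ha i s) (sq_nonneg _)
    have h6 : 0 ≤ ∑ i, ∑ j, n i j * ‖(q i - h i) - (q j - h j)‖ ^ 2 := Finset.sum_nonneg fun i _ =>
      Finset.sum_nonneg fun s _ => mul_nonneg (hn i s) (sq_nonneg _)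
    linarith
  have hEh : 2 * ∑ i, ∑ s, a i s * ‖h i - p s‖ ^ 2 + ∑ i, ∑ j, n i j * ‖h i - h j‖ ^ 2
      = -2 * ∑ i, ∑ s, a i s * inner ℝ (p s) (h i - p s) := by
    have h7 := hbal' h
    have h8 := hsw h
    simp only [real_inner_self_eq_norm_sq] at h8
    have h9 : ∑ i, ∑ s, a i s * ‖h i - p s‖ ^ 2 = ∑ i, ∑ s, a i s * inner ℝ (h i) (h i - p s)
        - ∑ i, ∑ s, a i s * inner ℝ (p s) (h i - p s) := by
      simp only [← Finset.sum_sub_distrib, ← mul_sub, ← inner_sub_left, real_inner_self_eq_norm_sq]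
    rw [h8, h9]
    linarith
  have hdiff : ∀ i s, p s - h i = ∑ s', lam i s' • (p s - p s') := by
    intro i s
    simp only [smul_sub, Finset.sum_sub_distrib, ← Finset.sum_smul, hlam, one_smul, hh]
  set C : S → S → ℝ := fun s s' => ∑ i, a i s * lam i s' with hC
  have hCform : ∀ R : S → S → ℝ, ∑ i, ∑ s, a i s * ∑ s', lam i s' * R s s'
      = ∑ s, ∑ s', C s s' * R s s' := by
    intro R
    simp only [Finset.mul_sum, hC, Finset.sum_mul]
    rw [Finset.sum_comm]
    refine Finset.sum_congr rfl fun s _ => ?_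
    rw [Finset.sum_comm]
    simp only [mul_assoc]
  have hlast : -2 * ∑ i, ∑ s, a i s * inner ℝ (p s) (h i - p s)
      = ∑ i, ∑ s, a i s * ∑ s', lam i s' * ‖p s - p s'‖ ^ 2 := by
    have h10 : -2 * ∑ i, ∑ s, a i s * inner ℝ (p s) (h i - p s)
        = 2 * ∑ i, ∑ s, a i s * ∑ s', lam i s' * inner ℝ (p s) (p s - p s') := by
      rw [neg_mul, ← mul_neg, ← Finset.sum_neg_distrib]
      congr 1
      refine Finset.sum_congr rfl fun i _ => ?_
      rw [← Finset.sum_neg_distrib]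
      refine Finset.sum_congr rfl fun s _ => ?_
      rw [← mul_neg, ← inner_neg_right, neg_sub, hdiff, inner_sum]
      simp only [inner_smul_right]
    rw [h10, hCform, hCform]
    have h11 : ∑ s, ∑ s', C s s' * inner ℝ (p s) (p s - p s')
        = ∑ s, ∑ s', C s s' * inner ℝ (p s') (p s' - p s) := by
      rw [Finset.sum_comm]
      refine Finset.sum_congr rfl fun s _ => Finset.sum_congr rfl fun s' _ => ?_
      rw [show C s' s = C s s' from hc s' s]
    rw [two_mul]
    conv_lhs => arg 2; rw [h11]
    simp only [← Finset.sum_add_distrib]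
    refine Finset.sum_congr rfl fun s _ => Finset.sum_congr rfl fun s' _ => ?_
    rw [← mul_add, ← real_inner_self_eq_norm_sq (p s - p s'), inner_sub_left,
      ← neg_sub (p s) (p s'), inner_neg_right]
    ring
  rw [hexp, hEh, hlast]
  linarith

/-- The hitting distributions `lam i` on the boundary of a network, together with the
sub-probabilities `kap i k` of hitting the boundary before `k`. -/
theorem exists_hitting_distributions {H : Type*} [NormedAddCommGroup H] [InnerProductSpace ℝ H]
    [Nonempty S] {a : T → S → ℝ} {n : T → T → ℝ}
    (ha : ∀ i s, 0 < a i s) (hn : ∀ i j, 0 ≤ n i j) (hsymm : ∀ i j, n i j = n j i)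
    (p : S → H) (q : T → H) :
    ∃ (lam : T → S → ℝ) (kap : T → T → S → ℝ),
      (∀ i s, 0 ≤ lam i s) ∧ (∀ i, ∑ s, lam i s = 1) ∧ (∀ i k s, 0 ≤ kap i k s) ∧
      (∀ i k, ∑ s, kap i k s ≤ 1) ∧
      (∀ i k s, lam i s - lam k s = kap i k s - (∑ s', kap i k s') * lam k s) ∧
      2 * ∑ i, ∑ s, a i s * ∑ s', lam i s' * ‖p s - p s'‖ ^ 2
        + ∑ i, ∑ k, n i k * ∑ s, ∑ s', kap i k s * lam k s' * ‖p s - p s'‖ ^ 2 ≤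
      (Fintype.card T + 1) * (2 * ∑ i, ∑ s, a i s * ‖q i - p s‖ ^ 2
        + ∑ i, ∑ j, n i j * ‖q i - q j‖ ^ 2) := by
  classical
  obtain ⟨v, hvs, hG, hv0, hvpos, hvle⟩ := exists_green ha hn hsymm
  set lam : T → S → ℝ := fun i s => ∑ k, v i k * a k s with hlamdef
  -- `v i k / v k k` is the probability of reaching `k` before the boundary; the walks that do so
  -- are removed from `lam i`.
  set kap : T → T → S → ℝ := fun i k s => lam i s - v i k / v k k * lam k s with hkapdef
  have hharm : ∀ i s, (∑ s, a i s + ∑ j, n i j) * lam i s - ∑ j, n i j * lam j s = a i s := by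
    intro i s
    have : (∑ s, a i s + ∑ j, n i j) * lam i s - ∑ j, n i j * lam j s
        = ∑ k, groundedLaplacian a n (fun j => v j k) i * a k s := by
      simp only [hlamdef, groundedLaplacian, sub_mul, Finset.sum_sub_distrib, Finset.mul_sum,
        Finset.sum_mul, mul_assoc]
      congr 1
      rw [Finset.sum_comm]
    rw [this]
    simp [hG]
  have hlam0 : ∀ i s, 0 ≤ lam i s := fun i s =>
    Finset.sum_nonneg fun k _ => mul_nonneg (hv0 i k) (ha k s).le
  -- The total mass and the constant `1` solve the same equation, whose solution is unique by the
  -- minimum principle.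
  have hlam1 : ∀ i, ∑ s, lam i s = 1 := by
    have hL : ∀ i, groundedLaplacian a n (fun j => ∑ s, lam j s) i
        = groundedLaplacian a n (fun _ => 1) i := by
      intro i
      have h1 : groundedLaplacian a n (fun j => ∑ s, lam j s) i = ∑ s, a i s := by
        refine Eq.trans ?_ (Finset.sum_congr rfl fun s _ => hharm i s)
        simp only [groundedLaplacian, Finset.sum_sub_distrib, Finset.mul_sum]
        congr 1
        rw [Finset.sum_comm]
      rw [h1]
      simp [groundedLaplacian]
    have hsub : ∀ x y : T → ℝ, ∀ i, groundedLaplacian a n (fun j => x j - y j) i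
        = groundedLaplacian a n x i - groundedLaplacian a n y i := by
      intro x y i
      simp only [groundedLaplacian, mul_sub, Finset.sum_sub_distrib]
      ring
    intro i
    have h1 := nonneg_of_groundedLaplacian_nonneg ha hn (x := fun j => ∑ s, lam j s - 1)
      (fun l _ => by rw [hsub, hL, sub_self]) i
    have h2 := nonneg_of_groundedLaplacian_nonneg ha hn (x := fun j => 1 - ∑ s, lam j s)
      (fun l _ => by rw [hsub, hL, sub_self]) i
    linarith
  have hkapsum : ∀ i k, ∑ s, kap i k s = 1 - v i k / v k k := by
    intro i k
    simp only [hkapdef, Finset.sum_sub_distrib, ← Finset.mul_sum, hlam1, mul_one]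
  have hc : ∀ s s', ∑ i, a i s * lam i s' = ∑ i, a i s' * lam i s := by
    intro s s'
    simp only [hlamdef, Finset.mul_sum]
    rw [Finset.sum_comm]
    refine Finset.sum_congr rfl fun i _ => Finset.sum_congr rfl fun j _ => ?_
    rw [hvs i j]; ring
  refine ⟨lam, kap, hlam0, hlam1, fun i k s => ?_, fun i k => ?_, fun i k s => ?_, ?_⟩
  · simp only [hkapdef, hlamdef, Finset.mul_sum, ← Finset.sum_sub_distrib]
    refine Finset.sum_nonneg fun j _ => ?_
    rw [← mul_assoc, ← sub_mul]
    refine mul_nonneg ?_ (ha j s).le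
    rw [sub_nonneg, div_mul_eq_mul_div, div_le_iff₀ (hvpos k)]
    exact hvle i j k
  · rw [hkapsum]
    have := div_nonneg (hv0 i k) (hvpos k).le
    linarith
  · rw [hkapsum]
    simp only [hkapdef]
    ring
  · have hdir := response_energy_le (fun i s => (ha i s).le) hn hsymm hlam1 hharm hc p q
    set R : S → S → ℝ := fun s s' => ‖p s - p s'‖ ^ 2 with hR
    have hR0 : ∀ s s', 0 ≤ R s s' := fun s s' => sq_nonneg _
    set Q := ∑ i, ∑ s, a i s * ∑ s', lam i s' * R s s' with hQ
    -- The harmonic equation for `lam` and the Green equation for `v`, both read at `k`.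
    have hnk : ∀ k s, ∑ i, n i k * kap i k s = lam k s / v k k - a k s := by
      intro k s
      have h1 := hharm k s
      have h2 := hG k k
      simp only [groundedLaplacian, if_true] at h2
      have h3 : ∑ i, n i k * kap i k s
          = ∑ i, n k i * lam i s - (∑ i, n k i * v i k) * (lam k s / v k k) := by
        rw [Finset.sum_mul, ← Finset.sum_sub_distrib]
        refine Finset.sum_congr rfl fun i _ => ?_
        rw [hsymm i k]; simp only [hkapdef]; ring
      have h4 : v k k * (lam k s / v k k) = lam k s := mul_div_cancel₀ _ (hvpos k).ne'
      rw [h3]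
      linear_combination h2 * (lam k s / v k k) - h1 - (∑ s, a k s + ∑ j, n k j) * h4
    have hsec : ∑ i, ∑ k, n i k * ∑ s, ∑ s', kap i k s * lam k s' * R s s'
        = ∑ k, ∑ s, ∑ s', (lam k s / v k k) * lam k s' * R s s' - Q := by
      rw [Finset.sum_comm, hQ, ← Finset.sum_sub_distrib]
      refine Finset.sum_congr rfl fun k _ => ?_
      simp only [Finset.mul_sum]
      rw [Finset.sum_comm, ← Finset.sum_sub_distrib]
      refine Finset.sum_congr rfl fun s _ => ?_
      rw [Finset.sum_comm, ← Finset.sum_sub_distrib]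
      refine Finset.sum_congr rfl fun s' _ => ?_
      have h5 := hnk k s
      calc ∑ i, n i k * (kap i k s * lam k s' * R s s')
          = (∑ i, n i k * kap i k s) * (lam k s' * R s s') := by
            rw [Finset.sum_mul]; exact Finset.sum_congr rfl fun i _ => by ring
        _ = _ := by rw [h5]; ring
    have hQform : Q = ∑ s, ∑ s', (∑ i, ∑ j, a i s * v i j * a j s') * R s s' := by
      simp only [hQ, hlamdef, Finset.mul_sum, Finset.sum_mul]
      rw [Finset.sum_comm]
      refine Finset.sum_congr rfl fun s _ => ?_
      rw [Finset.sum_comm]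
      refine Finset.sum_congr rfl fun s' _ => Finset.sum_congr rfl fun i _ =>
        Finset.sum_congr rfl fun j _ => by ring
    -- Entry by entry: expanding `lam` through `v`, this is `v i k * v k j / v k k ≤ v i j`.
    have hk : ∀ k, ∑ s, ∑ s', (lam k s / v k k) * lam k s' * R s s' ≤ Q := by
      intro k
      rw [hQform]
      refine Finset.sum_le_sum fun s _ => Finset.sum_le_sum fun s' _ => ?_
      refine mul_le_mul_of_nonneg_right ?_ (hR0 s s')
      simp only [hlamdef]
      rw [div_mul_eq_mul_div, div_le_iff₀ (hvpos k), Finset.sum_mul_sum, Finset.sum_mul]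
      refine Finset.sum_le_sum fun i _ => ?_
      rw [Finset.sum_mul]
      refine Finset.sum_le_sum fun j _ => ?_
      have h6 := mul_le_mul_of_nonneg_right (hvle i j k)
        (mul_nonneg (ha i s).le (ha j s').le)
      rw [hvs k i]
      linarith
    have hcard : ∑ k, ∑ s, ∑ s', (lam k s / v k k) * lam k s' * R s s' ≤ Fintype.card T * Q := by
      refine (Finset.sum_le_sum fun k _ => hk k).trans ?_
      simp
    have h7 := mul_le_mul_of_nonneg_left hdir
      (by positivity : (0 : ℝ) ≤ (Fintype.card T : ℝ) + 1)
    rw [hsec]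
    linarith

end Network

/-! ### Extension for a concave modulus. -/

/-- A weighted average of a concave function is bounded by any of its affine majorants, provided
the function is non-negative at `0`. -/
theorem sum_mul_concave_le {ι : Type*} [Fintype ι] {G : ℝ → ℝ} (hG0 : 0 ≤ G 0)
    {τ σ : ℝ} (hσ : ∀ t, 0 ≤ t → G t ≤ G τ + σ * (t - τ)) {w r : ι → ℝ}
    (hw : ∀ i, 0 ≤ w i) (hw1 : ∑ i, w i ≤ 1) (hr : ∀ i, 0 ≤ r i) :
    ∑ i, w i * G (r i) ≤ G τ + σ * (∑ i, w i * r i - τ) := by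
  have h1 : ∑ i, w i * G (r i) ≤ ∑ i, (w i * (G τ - σ * τ) + σ * (w i * r i)) :=
    Finset.sum_le_sum fun i _ => by
      have := mul_le_mul_of_nonneg_left (hσ (r i) (hr i)) (hw i)
      linarith
  rw [Finset.sum_add_distrib, ← Finset.sum_mul, ← Finset.mul_sum] at h1
  -- The supporting line is non-negative at `0`, so total mass below `1` does no harm.
  have h2 : 0 ≤ G τ - σ * τ := by
    have := hσ 0 le_rfl
    linarith
  have h3 := mul_le_mul_of_nonneg_right hw1 h2
  linarith

/-- Maps from a finite subset of a Hilbert space extend to finitely many further points, with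
quantitative control of the modulus of continuity. -/
theorem exists_extension_of_concave {H E S T : Type*} [NormedAddCommGroup H]
    [InnerProductSpace ℝ H] [NormedAddCommGroup E] [NormedSpace ℝ E] [Fintype S] [Nonempty S]
    [Fintype T] {G : ℝ → ℝ} (hG : ConcaveOn ℝ (Set.Ici 0) G) (hmono : StrictMonoOn G (Set.Ici 0))
    (hG0 : 0 ≤ G 0) {p : S → H} {q : T → H} (hpq : ∀ t s, q t ≠ p s)
    (hq : Function.Injective q) {f : S → E} {C : ℝ} (hC : 0 ≤ C)
    (hf : ∀ s s', ‖f s - f s'‖ ≤ C * G (‖p s - p s'‖ ^ 2)) :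
    ∃ g : T → E, (∀ t, g t ∈ convexHull ℝ (Set.range f)) ∧
      (∀ t s, ‖g t - f s‖ ≤ C * G ((Fintype.card T + 1) * ‖q t - p s‖ ^ 2)) ∧
      ∀ t t', ‖g t - g t'‖ ≤ C * G ((Fintype.card T + 1) * ‖q t - q t'‖ ^ 2) := by
  classical
  set N : ℝ := Fintype.card T + 1 with hN
  have hNpos : 0 < N := by positivity
  have hGpos : ∀ t, 0 ≤ t → 0 ≤ G t := fun t ht =>
    hG0.trans (hmono.monotoneOn (by simp) ht ht)
  have hsg : ∀ τ : ℝ, ∃ σ : ℝ, 0 < τ → 0 < σ ∧ ∀ t, 0 ≤ t → G t ≤ G τ + σ * (t - τ) := by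
    intro τ
    by_cases hτ : 0 < τ
    · obtain ⟨σ, h⟩ := hG.exists_pos_supergradient hmono hτ
      exact ⟨σ, fun _ => h⟩
    · exact ⟨0, fun h => absurd h hτ⟩
  choose σ hσ using hsg
  set K : Set (T → E) := Set.univ.pi fun _ => convexHull ℝ (Set.range f) with hK
  have hKc : IsCompact K := isCompact_univ_pi fun _ => (Set.finite_range f).isCompact_convexHull ℝ
  have hKconv : Convex ℝ K := convex_pi fun _ _ => convex_convexHull ℝ _
  set φ : (T × S) ⊕ (T × T) → (T → E) → ℝ := fun e g =>
    Sum.elim (fun e : T × S => ‖g e.1 - f e.2‖) (fun e : T × T => ‖g e.1 - g e.2‖) e with hφ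
  set r : (T × S) ⊕ (T × T) → ℝ := Sum.elim (fun e : T × S => N * ‖q e.1 - p e.2‖ ^ 2)
    (fun e : T × T => N * ‖q e.1 - q e.2‖ ^ 2) with hr
  suffices h : ∃ g ∈ K, ∀ e, φ e g ≤ C * G (r e) by
    obtain ⟨g, hgK, hg⟩ := h
    exact ⟨g, fun t => hgK t (Set.mem_univ t), fun t s => hg (Sum.inl (t, s)),
      fun t t' => hg (Sum.inr (t, t'))⟩
  refine exists_forall_le_of_forall_weights hKc ?_ ?_ ?_ (fun e => C * G (r e)) ?_
  · rintro (⟨t, s⟩ | ⟨t, t'⟩)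
    · refine ⟨hKconv, fun g _ g' _ α β hα hβ hαβ => ?_⟩
      have : (α • g + β • g') t - f s = α • (g t - f s) + β • (g' t - f s) := by
        simp only [Pi.add_apply, Pi.smul_apply, smul_sub]
        conv_lhs => rw [← one_smul ℝ (f s), ← hαβ, add_smul]
        abel
      simp only [hφ, Sum.elim_inl, this]
      refine (norm_add_le _ _).trans ?_
      rw [norm_smul, norm_smul, Real.norm_of_nonneg hα, Real.norm_of_nonneg hβ]
      rfl
    · refine ⟨hKconv, fun g _ g' _ α β hα hβ hαβ => ?_⟩
      have : (α • g + β • g') t - (α • g + β • g') t'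
          = α • (g t - g t') + β • (g' t - g' t') := by
        simp only [Pi.add_apply, Pi.smul_apply, smul_sub]
        abel
      simp only [hφ, Sum.elim_inr, this]
      refine (norm_add_le _ _).trans ?_
      rw [norm_smul, norm_smul, Real.norm_of_nonneg hα, Real.norm_of_nonneg hβ]
      rfl
  · rintro (⟨t, s⟩ | ⟨t, t'⟩)
    · simp only [hφ, Sum.elim_inl]; fun_prop
    · simp only [hφ, Sum.elim_inr]; fun_prop
  · rintro (⟨t, s⟩ | ⟨t, t'⟩) g <;> exact norm_nonneg _
  intro w hw
  set R : S → S → ℝ := fun s s' => ‖p s - p s'‖ ^ 2 with hR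
  set τ : T → S → ℝ := fun t s => N * ‖q t - p s‖ ^ 2 with hτ
  set τ' : T → T → ℝ := fun t t' => N * ‖q t - q t'‖ ^ 2 with hτ'
  set w₁ : T → S → ℝ := fun t s => w (Sum.inl (t, s)) with hw₁
  -- Ordered pairs carry independent weights; the network needs symmetric ones.
  set w₂ : T → T → ℝ := fun t t' => w (Sum.inr (t, t')) + w (Sum.inr (t', t)) with hw₂
  have hτpos : ∀ t s, 0 < τ t s := fun t s =>
    mul_pos hNpos (pow_pos (norm_pos_iff.2 (sub_ne_zero.2 (hpq t s))) 2)
  have hτ'pos : ∀ t t', t ≠ t' → 0 < τ' t t' := fun t t' h =>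
    mul_pos hNpos (pow_pos (norm_pos_iff.2 (sub_ne_zero.2 (hq.ne h))) 2)
  have hτ'symm : ∀ t t', τ' t t' = τ' t' t := fun t t' => by
    simp only [hτ', norm_sub_rev]
  -- On the diagonal `τ'` is `0`, where `G` may have infinite slope; such loops carry no energy and
  -- get conductance `0`.
  set σ' : T → T → ℝ := fun t t' => if t = t' then 0 else σ (τ' t t') with hσ'
  have hσ'symm : ∀ t t', σ' t t' = σ' t' t := fun t t' => by
    simp only [hσ', hτ'symm t t', eq_comm]
  obtain ⟨lam, kap, hlam0, hlam1, hkap0, hkap1, hdiff, henergy⟩ :=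
    exists_hitting_distributions (a := fun t s => w₁ t s * σ (τ t s))
      (n := fun t t' => w₂ t t' * σ' t t')
      (fun t s => mul_pos (hw _) (hσ _ (hτpos t s)).1)
      (fun t t' => mul_nonneg (add_pos (hw _) (hw _)).le (by
        simp only [hσ']
        split_ifs with h
        · exact le_rfl
        · exact (hσ _ (hτ'pos t t' h)).1.le))
      (fun t t' => by simp only [hw₂, hσ'symm t t', add_comm]) p q
  set g : T → E := fun t => ∑ s, lam t s • f s with hg
  have hgf : ∀ t s, g t - f s = ∑ s', lam t s' • (f s' - f s) := fun t s => by
    simp only [hg, smul_sub, Finset.sum_sub_distrib, ← Finset.sum_smul, hlam1, one_smul]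
  have hgg : ∀ t t', g t - g t' = ∑ s, ∑ s', (kap t t' s * lam t' s') • (f s - f s') := by
    intro t t'
    have h1 : ∀ s, ∑ s', (kap t t' s * lam t' s') • (f s - f s') = kap t t' s • (f s - g t') := by
      intro s
      simp only [mul_smul, ← Finset.smul_sum, smul_sub, Finset.sum_sub_distrib, ← Finset.sum_smul,
        hlam1, one_smul, hg]
    rw [Finset.sum_congr rfl fun s _ => h1 s]
    simp only [smul_sub, Finset.sum_sub_distrib, ← Finset.sum_smul]
    simp only [hg, Finset.smul_sum, smul_smul, ← Finset.sum_sub_distrib, ← sub_smul, hdiff]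
  set A : T → S → ℝ := fun t s => ∑ s', lam t s' * R s s' with hA
  set B : T → T → ℝ := fun t t' => ∑ s, ∑ s', kap t t' s * lam t' s' * R s s' with hB
  have hb1 : ∀ t s, ‖g t - f s‖ ≤ C * (G (τ t s) + σ (τ t s) * (A t s - τ t s)) := by
    intro t s
    rw [hgf]
    have h1 : ‖∑ s', lam t s' • (f s' - f s)‖ ≤ C * ∑ s', lam t s' * G (R s s') := by
      refine (norm_sum_le _ _).trans ?_
      rw [Finset.mul_sum]
      refine Finset.sum_le_sum fun s' _ => ?_
      rw [norm_smul, Real.norm_of_nonneg (hlam0 t s'), norm_sub_rev]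
      have := mul_le_mul_of_nonneg_left (hf s s') (hlam0 t s')
      simp only [hR]
      linarith
    exact h1.trans (mul_le_mul_of_nonneg_left (sum_mul_concave_le hG0
      (hσ _ (hτpos t s)).2 (hlam0 t) (hlam1 t).le (fun s' => sq_nonneg _)) hC)
  have hb2 : ∀ t t', ‖g t - g t'‖ ≤ C * (G (τ' t t') + σ' t t' * (B t t' - τ' t t')) := by
    intro t t'
    rcases eq_or_ne t t' with rfl | htt
    · have : 0 ≤ G (τ' t t) := hGpos _ (by simp [hτ'])
      simpa [hσ'] using mul_nonneg hC this
    rw [hgg]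
    have h1 : ‖∑ s, ∑ s', (kap t t' s * lam t' s') • (f s - f s')‖
        ≤ C * ∑ e : S × S, kap t t' e.1 * lam t' e.2 * G (R e.1 e.2) := by
      rw [Fintype.sum_prod_type, Finset.mul_sum]
      refine (norm_sum_le _ _).trans (Finset.sum_le_sum fun s _ => ?_)
      rw [Finset.mul_sum]
      refine (norm_sum_le _ _).trans (Finset.sum_le_sum fun s' _ => ?_)
      have h0 := mul_nonneg (hkap0 t t' s) (hlam0 t' s')
      rw [norm_smul, Real.norm_of_nonneg h0]
      have := mul_le_mul_of_nonneg_left (hf s s') h0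
      simp only [hR]
      linarith
    have h2 : ∑ e : S × S, kap t t' e.1 * lam t' e.2 ≤ 1 := by
      rw [Fintype.sum_prod_type]
      simpa only [← Finset.mul_sum, hlam1, mul_one] using hkap1 t t'
    have h3 := sum_mul_concave_le hG0 (hσ _ (hτ'pos t t' htt)).2
      (w := fun e : S × S => kap t t' e.1 * lam t' e.2) (r := fun e => R e.1 e.2)
      (fun e => mul_nonneg (hkap0 _ _ _) (hlam0 _ _)) h2 (fun e => sq_nonneg _)
    rw [Fintype.sum_prod_type (fun e : S × S => kap t t' e.1 * lam t' e.2 * R e.1 e.2)] at h3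
    simp only [hσ', if_neg htt]
    exact h1.trans (mul_le_mul_of_nonneg_left h3 hC)
  refine ⟨g, fun t _ => ?_, ?_⟩
  · exact (convex_convexHull ℝ _).sum_mem (fun s _ => hlam0 t s) (hlam1 t)
      fun s _ => subset_convexHull ℝ _ ⟨s, rfl⟩
  have hsym2 : ∀ ψ : T → T → ℝ, (∀ t t', ψ t t' = ψ t' t) →
      2 * ∑ t, ∑ t', w (Sum.inr (t, t')) * ψ t t' = ∑ t, ∑ t', w₂ t t' * ψ t t' := by
    intro ψ hψ
    have : ∑ t, ∑ t', w (Sum.inr (t', t)) * ψ t t' = ∑ t, ∑ t', w (Sum.inr (t, t')) * ψ t t' := by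
      rw [Finset.sum_comm]
      refine Finset.sum_congr rfl fun t _ => Finset.sum_congr rfl fun t' _ => ?_
      rw [hψ]
    simp only [hw₂, add_mul, Finset.sum_add_distrib, this]
    ring
  have hs1 : ∑ t, ∑ s, w₁ t s * ‖g t - f s‖
      ≤ ∑ t, ∑ s, w₁ t s * (C * (G (τ t s) + σ (τ t s) * (A t s - τ t s))) :=
    Finset.sum_le_sum fun t _ => Finset.sum_le_sum fun s _ =>
      mul_le_mul_of_nonneg_left (hb1 t s) (hw _).le
  have hs2 : ∑ t, ∑ t', w₂ t t' * ‖g t - g t'‖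
      ≤ ∑ t, ∑ t', w₂ t t' * (C * (G (τ' t t') + σ' t t' * (B t t' - τ' t t'))) :=
    Finset.sum_le_sum fun t _ => Finset.sum_le_sum fun s _ =>
      mul_le_mul_of_nonneg_left (hb2 t s) (add_pos (hw _) (hw _)).le
  have he1 : ∀ t s, w₁ t s * (C * (G (τ t s) + σ (τ t s) * (A t s - τ t s)))
      = w₁ t s * (C * G (τ t s)) + C * (w₁ t s * σ (τ t s) * A t s)
        - C * (N * (w₁ t s * σ (τ t s) * ‖q t - p s‖ ^ 2)) := fun t s => by
    simp only [hτ]; ring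
  have he2 : ∀ t t', w₂ t t' * (C * (G (τ' t t') + σ' t t' * (B t t' - τ' t t')))
      = w₂ t t' * (C * G (τ' t t')) + C * (w₂ t t' * σ' t t' * B t t')
        - C * (N * (w₂ t t' * σ' t t' * ‖q t - q t'‖ ^ 2)) := fun t s => by
    simp only [hτ']; ring
  simp only [he1, Finset.sum_add_distrib, Finset.sum_sub_distrib, ← Finset.mul_sum] at hs1
  simp only [he2, Finset.sum_add_distrib, Finset.sum_sub_distrib, ← Finset.mul_sum] at hs2
  -- The factor `N` in `τ` and `τ'` is the one in the energy inequality, so the first-order terms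
  -- sum to at most zero.
  have hen := mul_le_mul_of_nonneg_left henergy hC
  have hG1 := hsym2 (fun t t' => ‖g t - g t'‖) (fun t t' => norm_sub_rev _ _)
  have hG2 := hsym2 (fun t t' => C * G (τ' t t')) (fun t t' => by rw [hτ'symm])
  rw [Fintype.sum_sum_type, Fintype.sum_sum_type, Fintype.sum_prod_type, Fintype.sum_prod_type,
    Fintype.sum_prod_type, Fintype.sum_prod_type]
  change ∑ t, ∑ s, w₁ t s * ‖g t - f s‖ + ∑ t, ∑ t', w (Sum.inr (t, t')) * ‖g t - g t'‖
    ≤ ∑ t, ∑ s, w₁ t s * (C * G (τ t s)) + ∑ t, ∑ t', w (Sum.inr (t, t')) * (C * G (τ' t t'))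
  linarith

/-! ### Lipschitz constants on quasi-metric spaces. -/

namespace QuasiMetric

variable {X Y : Type*} {ρ : QuasiMetric X} {σ : QuasiMetric Y} {f : X → Y}

theorem lip_le {L : ℝ≥0} (h : ∀ x y, σ.dist (f x) (f y) ≤ L * ρ.dist x y) :
    ρ.lip σ f ≤ L :=
  iInf₂_le L h

/-- If a map is Lipschitz at all, then its Lipschitz constant is attained. -/
theorem exists_coe_eq_lip {L : ℝ≥0} (h : ∀ x y, σ.dist (f x) (f y) ≤ L * ρ.dist x y) :
    ∃ L₀ : ℝ≥0, (L₀ : ℝ≥0∞) = ρ.lip σ f ∧ ∀ x y, σ.dist (f x) (f y) ≤ L₀ * ρ.dist x y := by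
  set A : Set ℝ≥0 := {L | ∀ x y, σ.dist (f x) (f y) ≤ L * ρ.dist x y} with hA
  have hne : A.Nonempty := ⟨L, h⟩
  have hmem : ∀ x y, σ.dist (f x) (f y) ≤ sInf A * ρ.dist x y := by
    intro x y
    rcases eq_or_ne (ρ.dist x y) 0 with h0 | h0
    · simpa [h0] using h x y
    · rw [← div_le_iff₀ (pos_iff_ne_zero.2 h0)]
      exact le_csInf hne fun L' hL' => (div_le_iff₀ (pos_iff_ne_zero.2 h0)).2 (hL' x y)
  refine ⟨sInf A, le_antisymm (le_iInf₂ fun L' hL' => ?_) (lip_le hmem), hmem⟩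
  exact_mod_cast csInf_le (OrderBot.bddBelow A) hL'

/-- A map on a finite quasi-metric space is Lipschitz if it identifies points at distance zero. -/
theorem exists_lipschitz_bound [Finite X]
    (h : ∀ x y, ρ.dist x y = 0 → σ.dist (f x) (f y) = 0) :
    ∃ L : ℝ≥0, ∀ x y, σ.dist (f x) (f y) ≤ L * ρ.dist x y := by
  cases nonempty_fintype X
  refine ⟨∑ x, ∑ y, σ.dist (f x) (f y) / ρ.dist x y, fun x y => ?_⟩
  rcases eq_or_ne (ρ.dist x y) 0 with h0 | h0
  · simp [h x y h0]
  · rw [← div_le_iff₀ (pos_iff_ne_zero.2 h0)]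
    refine le_trans ?_ (Finset.single_le_sum (f := fun x => ∑ y, σ.dist (f x) (f y) / ρ.dist x y)
      (fun _ _ => zero_le) (Finset.mem_univ x))
    exact Finset.single_le_sum (f := fun y => σ.dist (f x) (f y) / ρ.dist x y)
      (fun _ _ => zero_le) (Finset.mem_univ y)

end QuasiMetric

/-! ### Functions concave in the squared distance. -/

section SqrtConcave

variable {F : ℝ≥0 → ℝ≥0}

theorem strictMono_of_comp_sqrt (hF : StrictMono fun t : ℝ≥0 => F (NNReal.sqrt t)) :
    StrictMono F := fun x y hxy => by
  have := hF (pow_lt_pow_left₀ hxy zero_le two_ne_zero)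
  simpa using this

theorem concaveOn_toReal_comp_sqrt
    (hF : ConcaveOn ℝ≥0 Set.univ fun t : ℝ≥0 => F (NNReal.sqrt t)) :
    ConcaveOn ℝ (Set.Ici 0) fun t : ℝ => (F (NNReal.sqrt t.toNNReal) : ℝ) := by
  refine ⟨convex_Ici 0, fun x hx y hy α β hα hβ hαβ => ?_⟩
  lift x to ℝ≥0 using hx
  lift y to ℝ≥0 using hy
  lift α to ℝ≥0 using hα
  lift β to ℝ≥0 using hβ
  have := hF.2 (Set.mem_univ x) (Set.mem_univ y) zero_le zero_le (by exact_mod_cast hαβ)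
  have h1 : (α : ℝ) • (x : ℝ) + (β : ℝ) • (y : ℝ) = ((α • x + β • y : ℝ≥0) : ℝ) := by
    simp
  rw [h1]
  simp only [Real.toNNReal_coe]
  have h2 := NNReal.coe_le_coe.2 this
  simpa using h2

theorem strictMonoOn_toReal_comp_sqrt (hF : StrictMono fun t : ℝ≥0 => F (NNReal.sqrt t)) :
    StrictMonoOn (fun t : ℝ => (F (NNReal.sqrt t.toNNReal) : ℝ)) (Set.Ici 0) := by
  intro x hx y hy hxy
  lift x to ℝ≥0 using hx
  lift y to ℝ≥0 using hy
  simpa using hF (by exact_mod_cast hxy : x < y)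

/-- Concavity between `0` and `c * x ^ 2`, with the term at `0` dropped. This crude bound makes the
supremum in the main theorem finite. -/
theorem sqrt_mul_le_of_concaveOn_comp_sqrt
    (hF : ConcaveOn ℝ≥0 Set.univ fun t : ℝ≥0 => F (NNReal.sqrt t)) {c : ℝ≥0} (hc : 1 ≤ c)
    (x : ℝ≥0) : F (NNReal.sqrt c * x) ≤ c * F x := by
  have hc0 : 0 < c := one_pos.trans_le hc
  have := hF.2 (Set.mem_univ (c * x ^ 2)) (Set.mem_univ 0) zero_le zero_le
    (add_tsub_cancel_of_le (inv_le_one_of_one_le₀ hc))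
  have h1 : c⁻¹ • (c * x ^ 2) + (1 - c⁻¹) • (0 : ℝ≥0) = x ^ 2 := by
    rw [smul_zero, add_zero, smul_eq_mul, ← mul_assoc, inv_mul_cancel₀ hc0.ne', one_mul]
  rw [h1] at this
  simp only [NNReal.sqrt_mul, NNReal.sqrt_sq, smul_eq_mul] at this
  have h2 := le_self_add.trans this
  rwa [inv_mul_le_iff₀ hc0] at h2

end SqrtConcave

/-! ### The extension theorem. -/

theorem theorem1p2
    {H : Type*} [NormedAddCommGroup H] [InnerProductSpace ℝ H] [CompleteSpace H]
    {E : Type*} [NormedAddCommGroup E] [NormedSpace ℝ E] [CompleteSpace E]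
    (F : ℝ≥0 → ℝ≥0)
    (hF_mono : StrictMono (fun t : ℝ≥0 => F (NNReal.sqrt t)))
    (hF_concave : ConcaveOn ℝ≥0 Set.univ (fun t : ℝ≥0 => F (NNReal.sqrt t)))
    (hF_zero : F 0 = 0)
    (X S : Set H) (hX : X.Finite) (hSX : S ⊆ X) (hS : S.Nonempty)
    (f : S → E) (m : ℕ) (hm : m = (X \ S).ncard) :
    ∃ g : X → E,
      (∀ s : S, g ⟨s, hSX s.2⟩ = f s) ∧
      (∀ x : X, g x ∈ closedConvexHull ℝ (Set.range f)) ∧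
      (((QuasiMetric.ofMetric H).transform F hF_zero).restrict X).lip
          (QuasiMetric.ofMetric E) g < ∞ ∧
      (((QuasiMetric.ofMetric H).transform F hF_zero).restrict X).lip
          (QuasiMetric.ofMetric E) g ≤
        (⨆ (x : ℝ≥0) (_ : 0 < x),
          (F (NNReal.sqrt ((m : ℝ≥0) + 1) * x) : ℝ≥0∞) / (F x : ℝ≥0∞)) *
        (((QuasiMetric.ofMetric H).transform F hF_zero).restrict S).lip
          (QuasiMetric.ofMetric E) f ∧
      ((∀ x : ℝ≥0, F x = x) →
        (((QuasiMetric.ofMetric H).transform F hF_zero).restrict X).lip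
            (QuasiMetric.ofMetric E) g ≤
          (NNReal.sqrt ((m : ℝ≥0) + 1) : ℝ≥0∞) *
          (((QuasiMetric.ofMetric H).transform F hF_zero).restrict S).lip
            (QuasiMetric.ofMetric E) f) := by
  classical
  have hFm := strictMono_of_comp_sqrt hF_mono
  have hFpos : ∀ x, 0 < x → 0 < F x := fun x hx => hF_zero ▸ hFm hx
  have : Finite S := (hX.subset hSX).to_subtype
  have : Finite ↥(X \ S) := (hX.subset Set.sdiff_subset).to_subtype
  have := Fintype.ofFinite S
  have := Fintype.ofFinite ↥(X \ S)
  have : Nonempty S := hS.to_subtype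
  have hcard : (Fintype.card ↥(X \ S) : ℝ) = m := by
    rw [hm, ← Nat.card_coe_set_eq, Nat.card_eq_fintype_card]
  set ρ := (QuasiMetric.ofMetric H).transform F hF_zero
  have hdist : ∀ x y, ρ.dist x y = F (nndist x y) := fun _ _ => rfl
  obtain ⟨L, hL⟩ : ∃ L : ℝ≥0, ∀ x y : S, nndist (f x) (f y) ≤ L * ρ.dist x y :=
    QuasiMetric.exists_lipschitz_bound (ρ := ρ.restrict S) (σ := QuasiMetric.ofMetric E)
      fun x y hxy => by
        have h0 : nndist (x : H) y = 0 := by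
          by_contra h
          exact (hFpos _ (pos_iff_ne_zero.2 h)).ne' hxy
        rw [Subtype.ext (nndist_eq_zero.1 h0)]
        exact nndist_self _
  obtain ⟨L₀, hL₀, hf⟩ := QuasiMetric.exists_coe_eq_lip (ρ := ρ.restrict S)
    (σ := QuasiMetric.ofMetric E) hL
  have hG : ∀ x y : H, (F (NNReal.sqrt (‖x - y‖ ^ 2).toNNReal) : ℝ) = F (nndist x y) := by
    intro x y
    have : (‖x - y‖ ^ 2).toNNReal = nndist x y ^ 2 := by
      rw [← dist_eq_norm, ← coe_nndist, ← NNReal.coe_pow, Real.toNNReal_coe]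
    rw [this, NNReal.sqrt_sq]
  have hGm : ∀ x y : H, (F (NNReal.sqrt ((Fintype.card ↥(X \ S) + 1) * ‖x - y‖ ^ 2).toNNReal) : ℝ)
      = F (NNReal.sqrt (m + 1) * nndist x y) := by
    intro x y
    have : ((Fintype.card ↥(X \ S) + 1) * ‖x - y‖ ^ 2).toNNReal = (m + 1) * nndist x y ^ 2 := by
      rw [← dist_eq_norm, ← coe_nndist, hcard, ← Real.toNNReal_coe (r := (m + 1) * _)]
      push_cast
      rfl
    rw [this, NNReal.sqrt_mul, NNReal.sqrt_sq]
  obtain ⟨g, hg, hgf, hgg⟩ := exists_extension_of_concave (concaveOn_toReal_comp_sqrt hF_concave)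
    (strictMonoOn_toReal_comp_sqrt hF_mono) (NNReal.coe_nonneg _)
    (p := fun s : S => (s : H)) (q := fun t : ↥(X \ S) => (t : H))
    (fun t s h => t.2.2 (h ▸ s.2)) Subtype.val_injective (f := f) (NNReal.coe_nonneg L₀)
    (fun s s' => by
      rw [hG, ← dist_eq_norm, ← coe_nndist]
      exact_mod_cast hf s s')
  simp only [hGm] at hgf hgg
  simp only [← dist_eq_norm, ← coe_nndist] at hgf hgg
  set k : X → E := fun x => if hx : (x : H) ∈ S then f ⟨x, hx⟩ else g ⟨x, x.2, hx⟩ with hk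
  have h1m : 1 ≤ NNReal.sqrt ((m : ℝ≥0) + 1) := by
    rw [NNReal.one_le_sqrt]
    exact le_add_self
  have hkey : ∀ x y : X, nndist (k x) (k y) ≤
      L₀ * F (NNReal.sqrt (m + 1) * nndist (x : H) y) := by
    intro x y
    by_cases hx : (x : H) ∈ S <;> by_cases hy : (y : H) ∈ S <;> simp only [hk, hx, hy, dite_true,
      dite_false]
    · refine (hf ⟨x, hx⟩ ⟨y, hy⟩).trans (mul_le_mul_right (hFm.monotone ?_) L₀)
      exact le_mul_of_one_le_left zero_le h1m
    · rw [nndist_comm, nndist_comm (x : H)]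
      exact_mod_cast hgf ⟨y, y.2, hy⟩ ⟨x, hx⟩
    · exact_mod_cast hgf ⟨x, x.2, hx⟩ ⟨y, hy⟩
    · exact_mod_cast hgg ⟨x, x.2, hx⟩ ⟨y, y.2, hy⟩
  have hlip : ∀ c : ℝ≥0, (∀ x y : X, F (NNReal.sqrt (m + 1) * nndist (x : H) y) ≤
      c * F (nndist (x : H) y)) →
      (ρ.restrict X).lip (QuasiMetric.ofMetric E) k ≤ (c : ℝ≥0∞) * L₀ := by
    intro c hc
    rw [← ENNReal.coe_mul]
    refine QuasiMetric.lip_le fun x y => (hkey x y).trans ?_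
    rw [mul_comm c, mul_assoc]
    exact mul_le_mul_right (hc x y) L₀
  have hFc : ∀ x, F (NNReal.sqrt ((m : ℝ≥0) + 1) * x) ≤ ((m : ℝ≥0) + 1) * F x :=
    sqrt_mul_le_of_concaveOn_comp_sqrt hF_concave le_add_self
  have hsup : (⨆ (x : ℝ≥0) (_ : 0 < x),
      (F (NNReal.sqrt ((m : ℝ≥0) + 1) * x) : ℝ≥0∞) / (F x : ℝ≥0∞)) ≤ ((m + 1 : ℝ≥0) : ℝ≥0∞) :=
    iSup₂_le fun x _ => ENNReal.div_le_of_le_mul (by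
      rw [← ENNReal.coe_mul]
      exact ENNReal.coe_le_coe.2 (hFc x))
  refine ⟨k, fun s => by simp [hk], fun x => ?_, ?_, ?_, fun hid => ?_⟩
  · by_cases hx : (x : H) ∈ S
    · simp only [hk, hx, dite_true]
      exact subset_closedConvexHull ⟨_, rfl⟩
    · simp only [hk, hx, dite_false]
      exact convexHull_subset_closedConvexHull (hg _)
  · exact (hlip (m + 1) fun _ _ => hFc _).trans_lt
      (ENNReal.mul_lt_top ENNReal.coe_lt_top ENNReal.coe_lt_top)
  · rw [← hL₀]
    -- Finiteness of the supremum lets it serve as a real constant in `hlip`.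
    have hc := ENNReal.coe_toNNReal (hsup.trans_lt ENNReal.coe_lt_top).ne
    rw [← hc]
    refine hlip _ fun x y => ?_
    rcases eq_or_ne (nndist (x : H) y) 0 with h0 | h0
    · simp [h0, hF_zero]
    · have h0 := pos_iff_ne_zero.2 h0
      have h2 := le_iSup₂ (f := fun (x : ℝ≥0) (_ : 0 < x) =>
        (F (NNReal.sqrt ((m : ℝ≥0) + 1) * x) : ℝ≥0∞) / (F x : ℝ≥0∞)) _ h0
      rw [← hc, ENNReal.div_le_iff_le_mul (Or.inl (by exact_mod_cast (hFpos _ h0).ne'))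
        (Or.inl ENNReal.coe_ne_top)] at h2
      exact_mod_cast h2
  · rw [← hL₀]
    exact hlip _ fun x y => by rw [hid, hid]
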